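/- For $n\ge 0$ let the $n\times n$ grid be the graph on the points $(i,j)\in\mathbb{Z}^2$, $0\le i,j<n$, with edges joining the points at unit distance. Let $m$ and $n$ be nonnegative integers with $m\le n/2$, choose any of the four corners of the $n\times n$ grid, and let $D$ be the set of the first $m$ vertices of the diagonal that starts at this corner and runs towards the centre; for the corner $(0,0)$ this is $D=\{(i,i):0\le i<m\}$, and for the other corners it is a mirror image of this set. Let $G$ be the subgraph of the grid induced by the vertices not in $D$. Then: 1. $|D|=m$. 2. If $n\ge 2$, then $G$ has pathwidth exactly $n-m$. 3. The largest square grid that is a minor of $G$ is exactly $(n-m)\times(n-m)$; that is, $n-m$ is the largest integer $k\ge 0$ such that the $k\times k$ grid is a minor of $G$. Here a path decomposition of a graph is a finite sequence of vertex sets (bags) such that every vertex lies in at least one bag, the bags containing any given vertex are consecutive, and the two endpoints of every edge lie in a common bag; its width is one less than the size of its largest bag, and the pathwidth of the graph is the minimum width of its path decompositions. A graph $H$ is a minor of $G$ if it is obtained from $G$ (up to isomorphism) by vertex deletions, edge deletions and edge contractions. -/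

import Mathlib

open SimpleGraph

/-- The `n × n` grid graph: its vertices are the lattice points `(i, j)` with `0 ≤ i, j < n`, and
its edges join the points at unit distance. -/
abbrev gridGraph (n : ℕ) : SimpleGraph (Fin n × Fin n) :=
  pathGraph n □ pathGraph n

/-- The graph left of the `n × n` grid after the deletion of the vertices in `D`. -/
abbrev damagedGrid (n : ℕ) (D : Finset (Fin n × Fin n)) : SimpleGraph {v // v ∉ D} :=
  (gridGraph n).induce {v | v ∉ D}

/-- `H` is a minor of `G`: there are disjoint vertex sets of `G`, one for each vertex of `H`, each
inducing a connected (hence nonempty) subgraph, such that adjacent vertices of `H` belong to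
sets joined by an edge of `G`.  Contracting the sets and deleting what is left over gives `H`. -/
def IsGraphMinor {W V : Type*} (H : SimpleGraph W) (G : SimpleGraph V) : Prop :=
  ∃ B : W → Set V,
    (∀ w, (G.induce (B w)).Connected) ∧
    (∀ u w, u ≠ w → Disjoint (B u) (B w)) ∧
    (∀ u w, H.Adj u w → ∃ x ∈ B u, ∃ y ∈ B w, G.Adj x y)

/-- A path decomposition of `G`: a finite sequence of bags such that every vertex lies in some bag,
the bags holding a given vertex are contiguous, and every edge has both ends in a common bag. -/
structure PathDecomposition {V : Type*} (G : SimpleGraph V) where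
  /-- the number of bags -/
  length : ℕ
  /-- the bags -/
  bag : Fin length → Finset V
  exists_mem : ∀ v, ∃ i, v ∈ bag i
  contiguous : ∀ v i j k, i ≤ j → j ≤ k → v ∈ bag i → v ∈ bag k → v ∈ bag j
  exists_adj : ∀ u v, G.Adj u v → ∃ i, u ∈ bag i ∧ v ∈ bag i

/-- The width of a path decomposition: one less than the size of its largest bag. -/
def PathDecomposition.width {V : Type*} {G : SimpleGraph V} (P : PathDecomposition G) : ℤ :=
  ((Finset.univ.sup fun i => (P.bag i).card : ℕ) : ℤ) - 1

/-- The pathwidth of `G`, the minimum width of its path decompositions, exists and equals `w`. -/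
def HasPathwidth {V : Type*} (G : SimpleGraph V) (w : ℤ) : Prop :=
  IsLeast (Set.range (PathDecomposition.width (G := G))) w

/-- The first `m` vertices of the diagonal that starts at a corner of the `n × n` grid.  The corner
is the one with first coordinate `n - 1` if `a` is true and `0` otherwise, and with second
coordinate `n - 1` if `b` is true and `0` otherwise. -/
def cornerDiagonal (n m : ℕ) (a b : Bool) : Finset (Fin n × Fin n) :=
  (Finset.univ.filter fun i : Fin n => (i : ℕ) < m).image fun i =>
    (if a then i.rev else i, if b then i.rev else i)

/-!
Away from the damaged corner, the graph contains an `(n - m) × n` rectangle. In a box product of two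
connected graphs, choose in each factor a vertex that is not a cut vertex: the fibres over these two
vertices and the crosses formed by the other vertices are a bramble that no set of `min |V| |W|`
vertices covers. So the rectangle, and every graph that has it as a minor, has pathwidth at least
`n - m`; a `k × k` grid minor likewise forces pathwidth at least `k`.

For the upper bound, sweep the damaged grid by a ray turning once around the centre of the
`2m × 2m` square at the damaged corner, starting and ending at the deleted diagonal. The concentric
rings around this centre number `n - m`, and the deleted diagonal cuts open those that are closed,
so each ring has at most one vertex already swept with a neighbour still to come.
-/

open scoped Finset

/-! ### Path decompositions and minors -/

theorem nonempty_iInter_of_ordConnected {α ι : Type*} [LinearOrder α] [Finite α] [Nonempty ι]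
    {I : ι → Set α} (hI : ∀ i, (I i).OrdConnected) (hinter : ∀ i j, (I i ∩ I j).Nonempty) :
    (⋂ i, I i).Nonempty := by
  have hgreatest (i : ι) : ∃ t, IsGreatest (I i) t :=
    Set.exists_max_image (I i) id (Set.toFinite _) ((hinter i i).mono Set.inter_subset_left)
  choose last hlast using hgreatest
  have hfirst : ∃ i, ∀ j, last i ≤ last j := by
    obtain ⟨_, ⟨i, rfl⟩, hi⟩ :=
      Set.exists_min_image (Set.range last) id (Set.toFinite _) (Set.range_nonempty last)
    exact ⟨i, fun j => hi _ ⟨j, rfl⟩⟩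
  obtain ⟨i, hi⟩ := hfirst
  -- The interval that ends first contains its last point in common with all the others.
  refine ⟨last i, Set.mem_iInter.2 fun j => ?_⟩
  obtain ⟨s, hsi, hsj⟩ := hinter i j
  exact (hI j).out hsj (hlast j).1 ⟨(hlast i).2 hsi, hi j⟩

namespace PathDecomposition

variable {V : Type*} {G : SimpleGraph V} (P : PathDecomposition G)

theorem width_le_of_card_bag_le {k : ℕ} (h : ∀ t, #(P.bag t) ≤ k + 1) : P.width ≤ k := by
  have : (Finset.univ.sup fun t => #(P.bag t)) ≤ k + 1 := Finset.sup_le fun t _ => h t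
  rw [width]
  omega

theorem le_width_of_lt_card_bag {k : ℕ} {t : Fin P.length} (h : k < #(P.bag t)) :
    (k : ℤ) ≤ P.width := by
  have : #(P.bag t) ≤ Finset.univ.sup fun t => #(P.bag t) :=
    Finset.le_sup (f := fun t => #(P.bag t)) (Finset.mem_univ t)
  rw [width]
  omega

theorem one_le_width_of_adj {u v : V} (huv : G.Adj u v) : 1 ≤ P.width := by
  obtain ⟨t, hu, hv⟩ := P.exists_adj u v huv
  exact_mod_cast P.le_width_of_lt_card_bag (Finset.one_lt_card.2 ⟨u, hu, v, hv, huv.ne⟩)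

/-- The indices of the bags that meet the vertex set `X`. -/
def meeting (X : Set V) : Set (Fin P.length) :=
  {t | ∃ x ∈ X, x ∈ P.bag t}

theorem ordConnected_meeting {X : Set V} (hX : (G.induce X).Preconnected) :
    (P.meeting X).OrdConnected := by
  refine ⟨fun i ⟨x, hx, hxi⟩ l ⟨y, hy, hyl⟩ j ⟨hij, hjl⟩ => ?_⟩
  obtain rfl | hij := hij.eq_or_lt
  · exact ⟨x, hx, hxi⟩
  by_cases hyj : ∃ s < j, y ∈ P.bag s
  · obtain ⟨s, hs, hys⟩ := hyj
    exact ⟨y, hy, P.contiguous y s j l hs.le hjl hys hyl⟩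
  -- On a walk from `x` to `y` in `X`, take the edge leaving the vertices present before time `j`.
  obtain ⟨p⟩ := hX ⟨x, hx⟩ ⟨y, hy⟩
  obtain ⟨d, -, ⟨s, hs, hds⟩, hd⟩ :=
    p.exists_boundary_dart {z | ∃ s < j, (z : V) ∈ P.bag s} ⟨i, hij, hxi⟩ hyj
  obtain ⟨t, htu, htv⟩ := P.exists_adj _ _ d.adj
  have hjt : j ≤ t := le_of_not_gt fun h => hd ⟨t, h, htv⟩
  exact ⟨d.fst, d.fst.2, P.contiguous _ s j t hs.le hjt hds htu⟩

theorem nonempty_meeting_inter_of_adj {X Y : Set V} {x y : V} (hx : x ∈ X) (hy : y ∈ Y)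
    (hxy : G.Adj x y) : (P.meeting X ∩ P.meeting Y).Nonempty := by
  obtain ⟨t, htx, hty⟩ := P.exists_adj x y hxy
  exact ⟨t, ⟨x, hx, htx⟩, ⟨y, hy, hty⟩⟩

theorem nonempty_meeting {X : Set V} (hX : X.Nonempty) : (P.meeting X).Nonempty := by
  obtain ⟨x, hx⟩ := hX
  obtain ⟨t, ht⟩ := P.exists_mem x
  exact ⟨t, x, hx, ht⟩

theorem encard_setOf_mem_meeting_le {W : Type*} {B : W → Set V}
    (hB : Pairwise (Function.onFun Disjoint B)) (t : Fin P.length) :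
    {w | t ∈ P.meeting (B w)}.encard ≤ #(P.bag t) := by
  have hmem (w : {w | t ∈ P.meeting (B w)}) : ∃ x : P.bag t, (x : V) ∈ B w := by
    obtain ⟨w, x, hx, hxt⟩ := w
    exact ⟨⟨x, hxt⟩, hx⟩
  choose f hf using hmem
  have hinj : Function.Injective f := fun u w huw => Subtype.ext <| by
    by_contra hne
    exact Set.disjoint_left.1 (hB hne) (hf u) (huw ▸ hf w)
  rw [← Set.encard_coe_eq_coe_finsetCard]
  exact Function.Embedding.encard_le ⟨f, hinj⟩

end PathDecomposition

namespace IsGraphMinor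

variable {W V : Type*} {H : SimpleGraph W} {G : SimpleGraph V}

theorem of_isContained (h : H ⊑ G) : IsGraphMinor H G := by
  obtain ⟨f⟩ := h
  refine ⟨fun w => {f w}, fun w => ?_, fun u w huw => ?_, fun u w huw => ?_⟩
  · exact Connected.of_subsingleton
  · exact Set.disjoint_singleton.2 (f.injective.ne huw)
  · exact ⟨_, rfl, _, rfl, f.toHom.map_adj huw⟩

/-- Contract the branch sets inside every bag. -/
theorem exists_width_le (h : IsGraphMinor H G) (P : PathDecomposition G) :
    ∃ Q : PathDecomposition H, Q.width ≤ P.width := by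
  classical
  obtain ⟨B, hconn, hdisj, hadj⟩ := h
  have hne (w : W) : (P.meeting (B w)).Nonempty :=
    P.nonempty_meeting (Set.nonempty_coe_sort.1 (hconn w).nonempty)
  have hencard (t) := P.encard_setOf_mem_meeting_le (fun u w => hdisj u w) t
  have hfin (t) : {w | t ∈ P.meeting (B w)}.Finite := Set.finite_of_encard_le_coe (hencard t)
  let Q : PathDecomposition H :=
    { length := P.length
      bag := fun t => (hfin t).toFinset
      exists_mem := fun w => (hne w).imp fun t ht => (hfin t).mem_toFinset.2 ht
      contiguous := fun w i j l hij hjl hi hl => by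
        rw [Set.Finite.mem_toFinset] at hi hl ⊢
        exact (P.ordConnected_meeting (hconn w).preconnected).out hi hl ⟨hij, hjl⟩
      exists_adj := fun u w huw => by
        obtain ⟨x, hx, y, hy, hxy⟩ := hadj u w huw
        obtain ⟨t, hu, hw⟩ := P.nonempty_meeting_inter_of_adj hx hy hxy
        exact ⟨t, (hfin t).mem_toFinset.2 hu, (hfin t).mem_toFinset.2 hw⟩ }
  have hcard (t) : #(Q.bag t) ≤ #(P.bag t) := by
    exact_mod_cast (hfin t).encard_eq_coe_toFinset_card ▸ hencard t
  refine ⟨Q, sub_le_sub_right (Nat.cast_le.2 ?_) 1⟩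
  exact Finset.sup_mono_fun fun t _ => hcard t

end IsGraphMinor

/-! ### Brambles -/

/-- Two vertex sets touch if they share a vertex or are joined by an edge. -/
def Touches {V : Type*} (G : SimpleGraph V) (X Y : Set V) : Prop :=
  ∃ x ∈ X, ∃ y ∈ Y, x = y ∨ G.Adj x y

/-- A bramble of `G`: a family of pairwise touching connected vertex sets. -/
structure IsBramble {V : Type*} (G : SimpleGraph V) (𝓑 : Set (Set V)) : Prop where
  connected : ∀ X ∈ 𝓑, (G.induce X).Connected
  pairwise_touches : 𝓑.Pairwise (Touches G)

instance {V : Type*} (G : SimpleGraph V) : Std.Symm (Touches G) where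
  symm _ _ := fun ⟨x, hx, y, hy, h⟩ => ⟨y, hy, x, hx, h.imp Eq.symm Adj.symm⟩

theorem IsBramble.exists_bag_meets {V : Type*} {G : SimpleGraph V} {𝓑 : Set (Set V)}
    (h𝓑 : IsBramble G 𝓑) (hne : 𝓑.Nonempty) (P : PathDecomposition G) :
    ∃ t, ∀ X ∈ 𝓑, ∃ x ∈ X, x ∈ P.bag t := by
  have : Nonempty 𝓑 := hne.to_subtype
  have hinter (X Y : 𝓑) : (P.meeting X ∩ P.meeting Y).Nonempty := by
    obtain rfl | hXY := eq_or_ne X Y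
    · rw [Set.inter_self]
      exact P.nonempty_meeting (Set.nonempty_coe_sort.1 (h𝓑.connected X X.2).nonempty)
    obtain ⟨x, hx, y, hy, rfl | hxy⟩ :=
      h𝓑.pairwise_touches X.2 Y.2 (Subtype.coe_ne_coe.2 hXY)
    · obtain ⟨t, ht⟩ := P.exists_mem x
      exact ⟨t, ⟨x, hx, ht⟩, ⟨x, hy, ht⟩⟩
    · exact P.nonempty_meeting_inter_of_adj hx hy hxy
  obtain ⟨t, ht⟩ := nonempty_iInter_of_ordConnected
    (fun X : 𝓑 => P.ordConnected_meeting (h𝓑.connected X X.2).preconnected) hinter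
  exact ⟨t, fun X hX => Set.mem_iInter.1 ht ⟨X, hX⟩⟩

theorem min_card_le_card_of_meets_crosses {α β : Type*} {A : Finset α} {B : Finset β}
    {T : Finset (α × β)} (hT : ∀ a ∈ A, ∀ b ∈ B, ∃ u ∈ T, u.1 = a ∨ u.2 = b) :
    min #A #B ≤ #T := by
  classical
  by_cases hA : A ⊆ T.image Prod.fst
  · exact min_le_of_left_le ((Finset.card_le_card hA).trans Finset.card_image_le)
  have hB : B ⊆ T.image Prod.snd := by
    obtain ⟨a, ha, haT⟩ := Finset.not_subset.1 hA
    intro b hb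
    obtain ⟨u, hu, rfl | rfl⟩ := hT a ha b hb
    · exact absurd (Finset.mem_image_of_mem _ hu) haT
    · exact Finset.mem_image_of_mem _ hu
  exact min_le_of_right_le ((Finset.card_le_card hB).trans Finset.card_image_le)

section BoxProd

variable {V W : Type*} {G : SimpleGraph V} {H : SimpleGraph W}

theorem connected_induce_prod {S : Set V} {T : Set W} (hS : (G.induce S).Connected)
    (hT : (H.induce T).Connected) : ((G □ H).induce (S ×ˢ T)).Connected := by
  let f : (G.induce S □ H.induce T) →g (G □ H).induce (S ×ˢ T) :=
    { toFun := fun v => ⟨(v.1, v.2), v.1.2, v.2.2⟩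
      map_rel' := by simp [boxProd_adj, Subtype.ext_iff] }
  exact (hS.boxProd hT).map f fun ⟨v, hv⟩ => ⟨(⟨v.1, hv.1⟩, ⟨v.2, hv.2⟩), rfl⟩

/-- The crosses of `(G - g) □ (H - h)`, together with the fibre of `G □ H` over `g` and the fibre
over `h` without the vertex `(g, h)`. A set that meets all of them has more than
`min |V| |W|` vertices. -/
def boxProdBramble (g : V) (h : W) : Set (Set (V × W)) :=
  insert ({g} ×ˢ Set.univ) (insert ({g}ᶜ ×ˢ {h})
    (Set.image2 (fun a b => {a} ×ˢ {h}ᶜ ∪ {g}ᶜ ×ˢ {b}) {g}ᶜ {h}ᶜ))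

variable {g : V} {h : W}

theorem forall_mem_boxProdBramble {p : Set (V × W) → Prop} :
    (∀ X ∈ boxProdBramble g h, p X) ↔ p ({g} ×ˢ Set.univ) ∧ p ({g}ᶜ ×ˢ {h}) ∧
      ∀ a, a ≠ g → ∀ b, b ≠ h → p ({a} ×ˢ {h}ᶜ ∪ {g}ᶜ ×ˢ {b}) := by
  simp only [boxProdBramble, Set.mem_insert_iff, forall_eq_or_imp, Set.forall_mem_image2,
    Set.mem_compl_singleton_iff]

theorem connected_of_mem_boxProdBramble (hH : H.Connected) (hg : (G.induce {g}ᶜ).Connected)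
    (hh : (H.induce {h}ᶜ).Connected) :
    ∀ X ∈ boxProdBramble g h, ((G □ H).induce X).Connected := by
  have hG₁ (a : V) : (G.induce {a}).Connected := .of_subsingleton
  have hH₁ (b : W) : (H.induce {b}).Connected := .of_subsingleton
  refine forall_mem_boxProdBramble.2 ⟨?_, connected_induce_prod hg (hH₁ h), fun a ha b hb => ?_⟩
  · exact connected_induce_prod (hG₁ g) ((induceUnivIso H).connected_iff.2 hH)
  · exact induce_union_connected (connected_induce_prod (hG₁ a) hh).preconnected
      (connected_induce_prod hg (hH₁ b)).preconnected ⟨(a, b), ⟨rfl, hb⟩, ⟨ha, rfl⟩⟩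

theorem pairwise_touches_boxProdBramble {g' : V} {h' : W} (hg : G.Adj g g') (hh : H.Adj h h') :
    (boxProdBramble g h).Pairwise (Touches (G □ H)) := by
  have fibres : Touches (G □ H) ({g} ×ˢ Set.univ) ({g}ᶜ ×ˢ {h}) :=
    ⟨(g, h), ⟨rfl, trivial⟩, (g', h), ⟨hg.ne', rfl⟩, .inr (boxProd_adj_left.2 hg)⟩
  simp only [boxProdBramble, Set.pairwise_insert_of_symm, Set.mem_insert_iff, forall_eq_or_imp,
    Set.forall_mem_image2]
  refine ⟨⟨?_, fun a ha b _ _ => ?_⟩, fun _ => fibres, fun a _ b _ _ => ?_⟩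
  · rintro _ ⟨a, ha, b, -, rfl⟩ _ ⟨c, -, d, hd, rfl⟩ -
    exact ⟨(a, d), .inl ⟨rfl, hd⟩, (a, d), .inr ⟨ha, rfl⟩, .inl rfl⟩
  · exact ⟨(a, h), ⟨ha, rfl⟩, (a, h'), .inl ⟨rfl, hh.ne'⟩, .inr (boxProd_adj_right.2 hh)⟩
  · exact ⟨(g, b), ⟨rfl, trivial⟩, (g', b), .inr ⟨hg.ne', rfl⟩, .inr (boxProd_adj_left.2 hg)⟩

variable [Fintype V] [Fintype W]

theorem min_card_lt_card_of_meets_boxProdBramble {T : Finset (V × W)}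
    (hT : ∀ X ∈ boxProdBramble g h, ∃ u ∈ X, u ∈ T) :
    min (Fintype.card V) (Fintype.card W) < #T := by
  classical
  obtain ⟨⟨r, ⟨hr, -⟩, hrT⟩, ⟨c, ⟨hcg, hch⟩, hcT⟩, hcross⟩ := forall_mem_boxProdBramble.1 hT
  let T' := {u ∈ T | u.1 ≠ g ∧ u.2 ≠ h}
  have hT' : min (Fintype.card V - 1) (Fintype.card W - 1) ≤ #T' := by
    rw [← Finset.card_univ, ← Finset.card_univ, ← Finset.card_erase_of_mem (Finset.mem_univ g),
      ← Finset.card_erase_of_mem (Finset.mem_univ h)]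
    refine min_card_le_card_of_meets_crosses fun a ha b hb => ?_
    replace ha := Finset.ne_of_mem_erase ha
    replace hb := Finset.ne_of_mem_erase hb
    obtain ⟨u, ⟨hu₁, hu₂⟩ | ⟨hu₁, hu₂⟩, huT⟩ := hcross a ha b hb
    · exact ⟨u, Finset.mem_filter.2 ⟨huT, hu₁.trans_ne ha, hu₂⟩, .inl hu₁⟩
    · exact ⟨u, Finset.mem_filter.2 ⟨huT, hu₁, hu₂.trans_ne hb⟩, .inr hu₂⟩
  have hcT' : c ∉ T' := fun hc => (Finset.mem_filter.1 hc).2.2 hch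
  have hrT' : r ∉ insert c T' := by
    rw [Finset.mem_insert, not_or]
    exact ⟨fun hrc => hcg (hrc ▸ hr), fun hr' => (Finset.mem_filter.1 hr').2.1 hr⟩
  have hsub : insert r (insert c T') ⊆ T := by
    simp [Finset.insert_subset_iff, hrT, hcT, T']
  have hcard := Finset.card_le_card hsub
  rw [Finset.card_insert_of_notMem hrT', Finset.card_insert_of_notMem hcT'] at hcard
  omega

theorem min_card_le_width_boxProd [Nontrivial (V × W)] (hG : G.Connected) (hH : H.Connected)
    (P : PathDecomposition (G □ H)) :
    (min (Fintype.card V) (Fintype.card W) : ℕ) ≤ P.width := by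
  by_cases hVW : Nontrivial V ∧ Nontrivial W
  · obtain ⟨_, _⟩ := hVW
    obtain ⟨g, hg⟩ := hG.exists_connected_induce_compl_singleton_of_finite_nontrivial
    obtain ⟨h, hh⟩ := hH.exists_connected_induce_compl_singleton_of_finite_nontrivial
    obtain ⟨g', hgg'⟩ := hG.preconnected.exists_adj_of_nontrivial g
    obtain ⟨h', hhh'⟩ := hH.preconnected.exists_adj_of_nontrivial h
    have hbramble : IsBramble (G □ H) (boxProdBramble g h) :=
      ⟨connected_of_mem_boxProdBramble hH hg hh, pairwise_touches_boxProdBramble hgg' hhh'⟩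
    obtain ⟨t, ht⟩ := hbramble.exists_bag_meets (Set.insert_nonempty _ _) P
    exact P.le_width_of_lt_card_bag (min_card_lt_card_of_meets_boxProdBramble ht)
  · have hmin : min (Fintype.card V) (Fintype.card W) ≤ 1 := by
      simp only [← Fintype.one_lt_card_iff_nontrivial] at hVW
      omega
    obtain ⟨v⟩ := (hG.boxProd hH).nonempty
    obtain ⟨w, hvw⟩ := (hG.boxProd hH).preconnected.exists_adj_of_nontrivial v
    exact le_trans (mod_cast hmin) (P.one_le_width_of_adj hvw)

end BoxProd

/-! ### Vertex orderings -/

namespace PathDecomposition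

variable {V : Type*} (G : SimpleGraph V)

open Classical in
/-- The path decomposition of `G` obtained by sweeping a linear order of its vertices: the bag of
`v` holds `v` and the earlier vertices that still have a neighbour at or after `v`. -/
noncomputable def ofLinearOrder [Fintype V] [LinearOrder V] : PathDecomposition G where
  length := Fintype.card V
  bag i := {u | u ≤ Fintype.orderIsoFinOfCardEq V rfl i ∧
    (u = Fintype.orderIsoFinOfCardEq V rfl i ∨
      ∃ w, G.Adj u w ∧ Fintype.orderIsoFinOfCardEq V rfl i ≤ w)}
  exists_mem v := by
    obtain ⟨i, rfl⟩ := (Fintype.orderIsoFinOfCardEq V rfl).surjective v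
    exact ⟨i, by simp⟩
  contiguous v i j l hij hjl hi hl := by
    rw [← (Fintype.orderIsoFinOfCardEq V rfl).le_iff_le] at hij hjl
    simp only [Finset.mem_filter_univ] at hi hl ⊢
    refine ⟨hi.1.trans hij, hl.2.imp (fun hv => ?_) fun ⟨w, hvw, hw⟩ => ⟨w, hvw, hjl.trans hw⟩⟩
    exact le_antisymm (hi.1.trans hij) (hv ▸ hjl)
  exists_adj u v huv := by
    wlog h : u ≤ v generalizing u v
    · obtain ⟨i, hv, hu⟩ := this v u huv.symm (le_of_not_ge h)
      exact ⟨i, hu, hv⟩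
    obtain ⟨i, rfl⟩ := (Fintype.orderIsoFinOfCardEq V rfl).surjective v
    exact ⟨i, by simpa using ⟨h, .inr ⟨_, huv, le_rfl⟩⟩, by simp⟩

variable {G} {k : ℕ} {lane : V → Fin k}

theorem width_ofLinearOrder_le [Fintype V] [LinearOrder V]
    (hlane : ∀ u v w, lane u = lane v → u < v → G.Adj u w → w ≤ v) :
    (ofLinearOrder G).width ≤ k := by
  classical
  refine width_le_of_card_bag_le _ fun i => ?_
  set v := Fintype.orderIsoFinOfCardEq V rfl i
  have hcard : #(Finset.univ : Finset (Option (Fin k))) = k + 1 := by simp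
  rw [← hcard]
  -- Apart from `v` itself, the vertices of the bag lie in distinct lanes.
  refine Finset.card_le_card_of_injOn (fun u => if u = v then none else some (lane u))
    (fun _ _ => Finset.mem_coe.2 (Finset.mem_univ _)) fun u hu u' hu' huu' => ?_
  by_contra hne
  wlog hlt : u < u' generalizing u u'
  · exact this u' hu' u hu huu'.symm (Ne.symm hne) (lt_of_le_of_ne (not_lt.1 hlt) (Ne.symm hne))
  obtain ⟨-, hu⟩ := (Finset.mem_filter_univ u).1 hu
  obtain ⟨hu'v, -⟩ := (Finset.mem_filter_univ u').1 hu'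
  have hu_ne : u ≠ v := (hlt.trans_le hu'v).ne
  have hu'_ne : u' ≠ v := by
    rintro rfl
    simp [hu_ne] at huu'
  have huu' : lane u = lane u' := by simpa [hu_ne, hu'_ne] using huu'
  obtain ⟨w, huw, hvw⟩ := hu.resolve_left hu_ne
  exact hu'_ne (hu'v.antisymm (hvw.trans (hlane u u' w huu' hlt huw)))

/-- By `hdone`, at most one vertex of each lane has neighbours still to come when the vertices are
swept by increasing `time`. -/
theorem exists_width_le_of_lanes [Finite V] (time : V → ℕ)
    (hinj : Function.Injective fun v => (time v, lane v))
    (hdone : ∀ u v w, lane u = lane v → time u < time v → G.Adj u w → w = v ∨ time w < time v) :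
    ∃ P : PathDecomposition G, P.width ≤ k := by
  have := Fintype.ofFinite V
  let _ : LinearOrder V :=
    LinearOrder.lift' (fun v => toLex (time v, lane v)) (toLex.injective.comp hinj)
  have lt_iff (u v : V) : u < v ↔ time u < time v ∨ time u = time v ∧ lane u < lane v :=
    Prod.Lex.toLex_lt_toLex
  refine ⟨ofLinearOrder G, width_ofLinearOrder_le (lane := lane) fun u v w hl huv huw => ?_⟩
  have htime : time u < time v := by simpa [lt_iff, hl] using huv
  obtain rfl | h := hdone u v w hl htime huw
  · exact le_rfl
  · exact ((lt_iff w v).2 (.inl h)).le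

end PathDecomposition

/-! ### The damaged grid -/

theorem isContained_pathGraph_of_le {k l : ℕ} (h : k ≤ l) : pathGraph k ⊑ pathGraph l :=
  ⟨⟨⟨Fin.castLE h, by simp [pathGraph_adj]⟩, Fin.castLE_injective h⟩⟩

theorem isContained_boxProd {V V' W W' : Type*} {G : SimpleGraph V} {G' : SimpleGraph V'}
    {H : SimpleGraph W} {H' : SimpleGraph W'} (hG : G ⊑ G') (hH : H ⊑ H') :
    (G □ H) ⊑ (G' □ H') := by
  obtain ⟨f⟩ := hG
  obtain ⟨f'⟩ := hH
  refine ⟨⟨⟨Prod.map f f', fun {u v} huv => ?_⟩, f.injective.prodMap f'.injective⟩⟩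
  rw [boxProd_adj] at huv ⊢
  exact huv.imp (.imp f.toHom.map_adj (congrArg f')) (.imp f'.toHom.map_adj (congrArg f))

theorem IsGraphMinor.min_le_width_of_pathGraph_boxProd {V : Type*} {G : SimpleGraph V} {k l : ℕ}
    (hkl : 1 < k * l) (h : IsGraphMinor (pathGraph k □ pathGraph l) G) (P : PathDecomposition G) :
    (min k l : ℕ) ≤ P.width := by
  have : Nontrivial (Fin k × Fin l) := by
    simpa [← Fintype.one_lt_card_iff_nontrivial] using hkl
  obtain ⟨i, j⟩ := Classical.arbitrary (Fin k × Fin l)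
  have : Nonempty (Fin k) := ⟨i⟩
  have : Nonempty (Fin l) := ⟨j⟩
  obtain ⟨Q, hQ⟩ := h.exists_width_le P
  simpa using (min_card_le_width_boxProd ⟨pathGraph_preconnected k⟩
    ⟨pathGraph_preconnected l⟩ Q).trans hQ

/-- The automorphism of the grid that moves the corner `(0, 0)` to the corner selected by `a` and
`b` as in `cornerDiagonal`. -/
def gridReflection (n : ℕ) (a b : Bool) : gridGraph n ≃g gridGraph n where
  toEquiv := .prodCongr (if a then Fin.revPerm else .refl _) (if b then Fin.revPerm else .refl _)
  map_rel_iff' := by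
    have hrev (i j : Fin n) : (pathGraph n).Adj i.rev j.rev ↔ (pathGraph n).Adj i j := by
      simp only [pathGraph_adj, Fin.val_rev]
      omega
    cases a <;> cases b <;> simp [boxProd_adj, hrev]

theorem cornerDiagonal_eq_image (n m : ℕ) (a b : Bool) :
    cornerDiagonal n m a b = (cornerDiagonal n m false false).image (gridReflection n a b) := by
  rw [cornerDiagonal, cornerDiagonal, Finset.image_image]
  cases a <;> cases b <;> rfl

theorem mem_cornerDiagonal_false {n m : ℕ} {v : Fin n × Fin n} :
    v ∈ cornerDiagonal n m false false ↔ v.1 = v.2 ∧ (v.1 : ℕ) < m := by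
  simp only [cornerDiagonal, Finset.mem_image, Finset.mem_filter_univ, Prod.ext_iff,
    Bool.false_eq_true, if_false]
  exact ⟨fun ⟨i, hi, h₁, h₂⟩ => ⟨h₁.symm.trans h₂, h₁ ▸ hi⟩, fun ⟨h, hm⟩ => ⟨v.1, hm, rfl, h⟩⟩

theorem card_cornerDiagonal {n m : ℕ} (hm : m ≤ n) (a b : Bool) :
    #(cornerDiagonal n m a b) = m := by
  have hdiag : Function.Injective fun i : Fin n => (i, i) := fun i j h => congrArg Prod.fst h
  rw [cornerDiagonal_eq_image, Finset.card_image_of_injective _ (gridReflection n a b).injective]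
  refine (Finset.card_image_of_injective _ hdiag).trans ?_
  rw [Fin.card_filter_val_lt, min_eq_right hm]

theorem gridReflection_mem_cornerDiagonal {n m : ℕ} {a b : Bool} {v : Fin n × Fin n} :
    gridReflection n a b v ∈ cornerDiagonal n m a b ↔ v ∈ cornerDiagonal n m false false := by
  rw [cornerDiagonal_eq_image, (gridReflection n a b).injective.mem_finset_image]

/-- The reflection of the grid that moves the corner `(0, 0)` to the chosen corner, restricted to
the vertices that are left. It reduces the four corners to one. -/
def damagedGridIso (n m : ℕ) (a b : Bool) :
    damagedGrid n (cornerDiagonal n m false false) ≃g damagedGrid n (cornerDiagonal n m a b) :=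
  (gridReflection n a b).induce <|
    (gridReflection n a b).toEquiv.bijOn fun _ => not_congr gridReflection_mem_cornerDiagonal

theorem isContained_damagedGrid (n m : ℕ) (a b : Bool) :
    (pathGraph (n - m) □ pathGraph n) ⊑ damagedGrid n (cornerDiagonal n m a b) := by
  suffices h : (pathGraph (n - m) □ pathGraph n) ⊑ damagedGrid n (cornerDiagonal n m false false)
    from h.trans ⟨(damagedGridIso n m a b).toCopy⟩
  let f (v : Fin (n - m) × Fin n) : {v // v ∉ cornerDiagonal n m false false} :=
    ⟨(⟨v.1 + m, by omega⟩, v.2), by simp [mem_cornerDiagonal_false]⟩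
  refine ⟨⟨⟨f, fun {u v} huv => ?_⟩, fun u v huv => ?_⟩⟩
  · change (gridGraph n).Adj (f u).1 (f v).1
    simp only [f, boxProd_adj, pathGraph_adj, Fin.ext_iff] at huv ⊢
    omega
  · simpa [f, Prod.ext_iff, Fin.ext_iff] using huv

theorem isGraphMinor_gridGraph_damagedGrid (n m : ℕ) (a b : Bool) :
    IsGraphMinor (gridGraph (n - m)) (damagedGrid n (cornerDiagonal n m a b)) :=
  .of_isContained <| (isContained_boxProd .rfl (isContained_pathGraph_of_le (n.sub_le m))).trans
    (isContained_damagedGrid n m a b)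

section Spiral

variable {n m : ℕ}

/-- The ring holding `v`, when the grid is covered by concentric square rings around the centre of
the `2m × 2m` square at the corner `(0, 0)`, counted outwards from `0`. -/
def spiralLane (m : ℕ) (v : Fin n × Fin n) : ℕ :=
  max (m - 1 - min (v.1 : ℕ) v.2) (max (v.1 : ℕ) v.2 - m)

/-- The time at which `v` is reached by a ray that turns once around the centre of the `2m × 2m`
square at the corner `(0, 0)`, starting and ending at the deleted diagonal. -/
def spiralTime (m : ℕ) (v : Fin n × Fin n) : ℕ :=
  if v.1 ≤ v.2 then
    if (v.1 + v.2 : ℕ) < 2 * m then v.2 else n + v.1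
  else
    if 2 * m ≤ v.1 + v.2 + 1 then 3 * n - v.2 else 4 * n - v.1

theorem spiral_sector {v : Fin n × Fin n} (hv : v ∉ cornerDiagonal n m false false) :
    (v.1 < v.2 ∧ (v.1 + v.2 : ℕ) < 2 * m ∧ spiralTime m v = v.2 ∧
      spiralLane m v + v.1 + 1 = m) ∨
    (v.1 ≤ v.2 ∧ 2 * m ≤ v.1 + v.2 ∧ spiralTime m v = n + v.1 ∧
      spiralLane m v + m = v.2) ∨
    (v.2 < v.1 ∧ 2 * m ≤ v.1 + v.2 + 1 ∧ spiralTime m v + v.2 = 3 * n ∧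
      spiralLane m v + m = v.1) ∨
    (v.2 < v.1 ∧ (v.1 + v.2 + 1 : ℕ) < 2 * m ∧ spiralTime m v + v.1 = 4 * n ∧
      spiralLane m v + v.2 + 1 = m) := by
  rw [mem_cornerDiagonal_false] at hv
  unfold spiralTime spiralLane
  split_ifs <;> omega

theorem spiralLane_lt (hm : 2 * m ≤ n) (v : Fin n × Fin n) : spiralLane m v < n - m := by
  unfold spiralLane
  omega

theorem eq_of_spiralTime_eq {u v : Fin n × Fin n} (hu : u ∉ cornerDiagonal n m false false)
    (hv : v ∉ cornerDiagonal n m false false) (htime : spiralTime m u = spiralTime m v)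
    (hlane : spiralLane m u = spiralLane m v) : u = v := by
  have hsu := spiral_sector hu
  have hsv := spiral_sector hv
  ext <;> omega

theorem spiralTime_lt_of_adj {u v w : Fin n × Fin n}
    (hu : u ∉ cornerDiagonal n m false false) (hv : v ∉ cornerDiagonal n m false false)
    (hw : w ∉ cornerDiagonal n m false false) (hlane : spiralLane m u = spiralLane m v)
    (htime : spiralTime m u < spiralTime m v) (huw : (gridGraph n).Adj u w) (hwv : w ≠ v) :
    spiralTime m w < spiralTime m v := by
  have hsv := spiral_sector hv
  have hsw := spiral_sector hw
  simp only [boxProd_adj, pathGraph_adj] at huw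
  rw [Ne, Prod.ext_iff] at hwv
  rcases spiral_sector hu with h | h | h | h <;> omega

end Spiral

theorem exists_width_damagedGrid_le {n m : ℕ} (hm : 2 * m ≤ n) (a b : Bool) :
    ∃ P : PathDecomposition (damagedGrid n (cornerDiagonal n m a b)), P.width ≤ (n - m : ℕ) := by
  obtain ⟨P, hP⟩ : ∃ P : PathDecomposition (damagedGrid n (cornerDiagonal n m false false)),
      P.width ≤ (n - m : ℕ) :=
    PathDecomposition.exists_width_le_of_lanes (lane := fun v => ⟨_, spiralLane_lt hm v.1⟩)
      (fun v => spiralTime m v.1)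
      (fun u v huv => Subtype.ext <| eq_of_spiralTime_eq u.2 v.2 (congrArg Prod.fst huv)
        (congrArg (fun p => p.2.1) huv))
      (fun u v w hlane htime huw => or_iff_not_imp_left.2 fun hwv =>
        spiralTime_lt_of_adj u.2 v.2 w.2 (Fin.ext_iff.1 hlane) htime huw
          (Subtype.coe_ne_coe.2 hwv))
  obtain ⟨Q, hQ⟩ :=
    (IsGraphMinor.of_isContained ⟨(damagedGridIso n m a b).symm.toCopy⟩).exists_width_le P
  exact ⟨Q, hQ.trans hP⟩

theorem le_width_damagedGrid {n m : ℕ} (hm : 2 * m ≤ n) (hn : 2 ≤ n) {a b : Bool}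
    (P : PathDecomposition (damagedGrid n (cornerDiagonal n m a b))) :
    (n - m : ℕ) ≤ P.width := by
  have hcard : 1 < (n - m) * n := by nlinarith [show 1 ≤ n - m by omega]
  have hminor := IsGraphMinor.of_isContained (isContained_damagedGrid n m a b)
  simpa only [min_eq_left (n.sub_le m)] using hminor.min_le_width_of_pathGraph_boxProd hcard P

theorem le_of_isGraphMinor_gridGraph_damagedGrid {n m k : ℕ} (hm : 2 * m ≤ n) {a b : Bool}
    (hk : IsGraphMinor (gridGraph k) (damagedGrid n (cornerDiagonal n m a b))) : k ≤ n - m := by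
  obtain rfl | rfl | hk₂ : k = 0 ∨ k = 1 ∨ 1 < k := by omega
  · exact Nat.zero_le _
  · obtain ⟨B, hconn, -, -⟩ := hk
    obtain ⟨v, -⟩ := (hconn (0, 0)).nonempty
    have := v.1.1.isLt
    omega
  · obtain ⟨P, hP⟩ := exists_width_damagedGrid_le hm a b
    have h := hk.min_le_width_of_pathGraph_boxProd (by nlinarith) P
    rw [min_self] at h
    exact_mod_cast h.trans hP

theorem mainTheorem4 (n m : ℕ) (hm : 2 * m ≤ n) (a b : Bool) :
    (cornerDiagonal n m a b).card = m ∧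
    (2 ≤ n → HasPathwidth (damagedGrid n (cornerDiagonal n m a b)) ((n : ℤ) - (m : ℤ))) ∧
    IsGreatest {k : ℕ | IsGraphMinor (gridGraph k) (damagedGrid n (cornerDiagonal n m a b))}
      (n - m) := by
  refine ⟨card_cornerDiagonal (by omega) a b, fun hn => ?_,
    isGraphMinor_gridGraph_damagedGrid n m a b,
    fun k hk => le_of_isGraphMinor_gridGraph_damagedGrid hm hk⟩
  obtain ⟨P, hP⟩ := exists_width_damagedGrid_le hm a b
  rw [← Nat.cast_sub (by omega)]
  refine ⟨⟨P, hP.antisymm (le_width_damagedGrid hm hn P)⟩, ?_⟩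
  rintro _ ⟨Q, rfl⟩
  exact le_width_damagedGrid hm hn Q
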